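/- Let $p$ be a prime, let $P$ be a finite $p$-group of order $p^m$ with $m\ge 1$, let $T$ be a $\mathbb{Z}_pP$-module that is free of finite rank over $\mathbb{Z}_p$, and let $r_0\ge 3m$. For $r \ge r_0$ put $M_r=T/p^{r+1}T$, and write $\mathrm{pro}_r\colon T\to M_r$ for the projection and $\mathrm{mul}^r\colon T/pT\to M_r$ for the map $x+pT\mapsto p^rx+p^{r+1}T$. All cochains are normalized, and $\Delta$ is the coboundary. For a group $Q$ acting on $T$, a sequence $(\alpha_r)_{r\ge r_0}$ with $\alpha_r\in C^n(Q,M_r)$ is a cochain sequence of level at most $k$ if there are $\rho\in C^n(Q,T)$, $\sigma\in C^n(Q,pT)$ and an integer $0\le\omega\le\min(k,r_0)$ with $\alpha_r=\mathrm{pro}_r(\rho+p^{r-\omega}\sigma)$ for all $r\ge r_0$. Let $\tau_\bullet=(\tau_r)_{r\ge r_0}$, $\tau_r\in Z^2(P,M_r)$, be a cochain sequence of level at most $m$, and let $G_{r+1}$ be the extension of $P$ by $M_r$ with cocycle $\tau_r$, that is, the set $M_r\times P$ with $(t_1,g_1)(t_2,g_2)=(t_1+{}^{g_1}t_2+\tau_r(g_1,g_2),\,g_1g_2)$.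 Let $\mathcal{E}$ be the set of triples $(U,f_\bullet,W)$ where $U\le P$ is elementary abelian, $f_\bullet$ is a cochain sequence of level at most $2m$ with $f_r\in C^1(U,M_r)$ and $\Delta f_r=\tau_r|_U$ for all $r\ge r_0$, and $W\le (T/pT)^U$. For such a triple let $$E_r(U,f_\bullet,W)=\{(\mathrm{mul}^r(w)-f_r(u),u)\mid u\in U,\ w\in W\},$$ an elementary abelian subgroup of $G_{r+1}$. For a group $G$, the objects of the Quillen category $\mathscr{A}_p(G)$ are the elementary abelian $p$-subgroups of $G$ (including the trivial one), and its morphisms are the homomorphisms induced by conjugation by elements of $G$. There is a subset $\mathcal{E}_0\subseteq\mathcal{E}$ such that for every conjugacy class $C$ of elementary abelian $p$-subgroups of $G_{r_0+1}$ there is exactly one $(U,f_\bullet,W)\in\mathcal{E}_0$ with $E_{r_0}(U,f_\bullet,W)\in C$. For every such $\mathcal{E}_0$, let $\mathcal{C}_r$ be the full subcategory of $\mathscr{A}_p(G_{r+1})$ on the objects $E_r(U,f_\bullet,W)$ with $(U,f_\bullet,W)\in\mathcal{E}_0$. Then: 1. $\mathcal{C}_r$ is a skeleton of $\mathscr{A}_p(G_{r+1})$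 for every $r\ge r_0$. 2. The categories $\mathcal{C}_r$, $r\ge r_0$, are all isomorphic to each other. Hence the Quillen categories $\mathscr{A}_p(G_{r+1})$, $r\ge r_0$, are all equivalent to each other. In particular, almost all groups in a coclass family have equivalent Quillen categories. Here a sequence $(G_j)$ is a coclass family if there are an infinite pro-$p$-group $S$ of finite coclass $c$, an $\ell\ge1$ such that $S_\ell=S/\gamma_\ell(S)$ is a finite $p$-group of coclass $c$ and order $p^m$ and $T=\gamma_\ell(S)\cong\mathbb{Z}_p^d$, a cocycle $\rho\in Z^2(S_\ell,T)$ defining the extension $S$ of $S_\ell$ by $T$, and $\eta\in Z^3(S_\ell,T)$, $\sigma\in C^2(S_\ell,T)$ with $\Delta\sigma=p^m\eta$, such that for all $j\ge 3m+1$ the group $G_j$ is isomorphic to the extension of $S_\ell$ by $T/p^jT$ with the cocycle induced by $\rho+p^{j-m}\sigma$. -/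

import Mathlib

open CategoryTheory

noncomputable section

namespace CochainSeq

/-! ### Normalized 2-cocycles and group extensions -/

/-- Normalized 2-cocycles of a group `G` with coefficients in a left `G`-module `M`,
i.e. the elements of `Z²(G, M)` for the normalized standard resolution. -/
@[ext]
structure Cocycle₂ (G M : Type*) [Group G] [AddCommGroup M] [DistribMulAction G M] where
  toFun : G → G → M
  map_one_left : ∀ g, toFun 1 g = 0
  map_one_right : ∀ g, toFun g 1 = 0
  coboundary_eq_zero : ∀ g h k,
    g • toFun h k - toFun (g * h) k + toFun g (h * k) - toFun g h = 0

/-- The extension `M.G` given by a normalized 2-cocycle `τ`: the underlying set is `M × G`. -/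
@[ext]
structure Extension {G M : Type*} [Group G] [AddCommGroup M] [DistribMulAction G M]
    (τ : Cocycle₂ G M) where
  fst : M
  snd : G

section extension

variable {G M : Type*} [Group G] [AddCommGroup M] [DistribMulAction G M] {τ : Cocycle₂ G M}

/-- `(t₁, g₁) (t₂, g₂) = (t₁ + g₁ t₂ + τ(g₁, g₂), g₁ g₂)`. -/
instance : Mul (Extension τ) :=
  ⟨fun x y => ⟨x.fst + x.snd • y.fst + τ.toFun x.snd y.snd, x.snd * y.snd⟩⟩

instance : One (Extension τ) := ⟨⟨0, 1⟩⟩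

instance : Inv (Extension τ) :=
  ⟨fun x => ⟨-(x.snd⁻¹ • x.fst) - τ.toFun x.snd⁻¹ x.snd, x.snd⁻¹⟩⟩

@[simp] theorem Extension.mul_fst (x y : Extension τ) :
    (x * y).fst = x.fst + x.snd • y.fst + τ.toFun x.snd y.snd := rfl
@[simp] theorem Extension.mul_snd (x y : Extension τ) : (x * y).snd = x.snd * y.snd := rfl
@[simp] theorem Extension.one_fst : (1 : Extension τ).fst = 0 := rfl
@[simp] theorem Extension.one_snd : (1 : Extension τ).snd = 1 := rfl
@[simp] theorem Extension.inv_fst (x : Extension τ) :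
    x⁻¹.fst = -(x.snd⁻¹ • x.fst) - τ.toFun x.snd⁻¹ x.snd := rfl
@[simp] theorem Extension.inv_snd (x : Extension τ) : x⁻¹.snd = x.snd⁻¹ := rfl

instance : Group (Extension τ) :=
  Group.ofLeftAxioms
    (by
      intro x y z
      ext
      · have h := τ.coboundary_eq_zero x.snd y.snd z.snd
        simp only [Extension.mul_fst, Extension.mul_snd, smul_add, mul_smul]
        rw [← sub_eq_zero]
        rw [← sub_eq_zero, sub_zero] at h
        rw [← neg_eq_zero, ← h]
        abel
      · exact mul_assoc _ _ _)
    (by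
      intro x
      ext
      · simp [τ.map_one_left]
      · simp)
    (by
      intro x
      ext
      · simp only [Extension.mul_fst, Extension.inv_fst, Extension.inv_snd, Extension.one_fst]
        abel
      · simp)

end extension

/-! ### The Quillen category -/

/-- Objects of the Quillen category `𝒜_p(G)`: the elementary abelian `p`-subgroups of `G`
(the trivial subgroup included). -/
@[ext]
structure QuillenCat (p : ℕ) (G : Type*) [Group G] where
  carrier : Subgroup G
  comm : ∀ x ∈ carrier, ∀ y ∈ carrier, x * y = y * x
  pow_eq_one : ∀ x ∈ carrier, x ^ p = 1

/-- Morphisms `E → E'` of the Quillen category: group homomorphisms induced by conjugation by an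
element of `G`. -/
@[ext]
structure QuillenCat.Hom {p : ℕ} {G : Type*} [Group G] (E E' : QuillenCat p G) where
  toHom : E.carrier →* E'.carrier
  exists_conj : ∃ g : G, ∀ x : E.carrier, (toHom x : G) = g * x * g⁻¹

instance (p : ℕ) (G : Type*) [Group G] : Category (QuillenCat p G) where
  Hom := QuillenCat.Hom
  id E := ⟨MonoidHom.id _, 1, by simp⟩
  comp φ ψ := ⟨ψ.toHom.comp φ.toHom, by
    obtain ⟨g, hg⟩ := φ.exists_conj
    obtain ⟨h, hh⟩ := ψ.exists_conj
    exact ⟨h * g, fun x => by simp [hg, hh, mul_assoc]⟩⟩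

/-- Two elementary abelian subgroups are conjugate in `G`. -/
def QuillenCat.AreConj {p : ℕ} {G : Type*} [Group G] (E E' : QuillenCat p G) : Prop :=
  ∃ g : G, E'.carrier = E.carrier.map (MulAut.conj g).toMonoidHom

/-! ### The modules `T / p^k T` -/

/-- The submodule `p^k T` of a `ℤ_p`-module `T`. -/
def powSubmodule (p : ℕ) [Fact p.Prime] (T : Type*) [AddCommGroup T] [Module ℤ_[p] T] (k : ℕ) :
    Submodule ℤ_[p] T :=
  LinearMap.range ((p : ℤ_[p]) ^ k • (LinearMap.id : T →ₗ[ℤ_[p]] T))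

theorem mem_powSubmodule {p : ℕ} [Fact p.Prime] {T : Type*} [AddCommGroup T] [Module ℤ_[p] T]
    {k : ℕ} {x : T} : x ∈ powSubmodule p T k ↔ ∃ y : T, (p : ℤ_[p]) ^ k • y = x := by
  simp [powSubmodule]

/-- The quotient `T / p^k T`. -/
def QuotPow (p : ℕ) [Fact p.Prime] (T : Type*) [AddCommGroup T] [Module ℤ_[p] T] (k : ℕ) :
    Type _ :=
  T ⧸ powSubmodule p T k

section quotPow

variable (p : ℕ) [Fact p.Prime] {T : Type*} [AddCommGroup T] [Module ℤ_[p] T]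

instance (k : ℕ) : AddCommGroup (QuotPow p T k) :=
  inferInstanceAs (AddCommGroup (T ⧸ powSubmodule p T k))

instance (k : ℕ) : Module ℤ_[p] (QuotPow p T k) :=
  inferInstanceAs (Module ℤ_[p] (T ⧸ powSubmodule p T k))

/-- The projection `T → T / p^k T`. -/
def proj (k : ℕ) : T →ₗ[ℤ_[p]] QuotPow p T k := (powSubmodule p T k).mkQ

variable {p} in
theorem proj_surjective (k : ℕ) : Function.Surjective (proj p k : T → QuotPow p T k) :=
  Submodule.mkQ_surjective _

/-- The map `T / p T → T / p^(r+1) T`, `x + p T ↦ p^r x + p^(r+1) T`. -/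
def mul (r : ℕ) : QuotPow p T 1 →ₗ[ℤ_[p]] QuotPow p T (r + 1) :=
  Submodule.mapQ (powSubmodule p T 1) (powSubmodule p T (r + 1))
    ((p : ℤ_[p]) ^ r • (LinearMap.id : T →ₗ[ℤ_[p]] T)) (by
      intro x hx
      obtain ⟨y, rfl⟩ := mem_powSubmodule.1 hx
      exact mem_powSubmodule.2 ⟨y, by rw [pow_add, mul_smul]; rfl⟩)

variable {p} in
@[simp] theorem mul_proj (r : ℕ) (x : T) :
    mul p r (proj p 1 x) = proj p (r + 1) ((p : ℤ_[p]) ^ r • x) := rfl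

variable {P : Type*} [Group P] [DistribMulAction P T] [SMulCommClass P ℤ_[p] T]

/-- The action of `P` on `T / p^k T` induced by the one on `T`. -/
instance (k : ℕ) : DistribMulAction P (QuotPow p T k) where
  smul g := Submodule.mapQ (powSubmodule p T k) (powSubmodule p T k)
    (DistribSMul.toLinearMap ℤ_[p] T g) (by
      intro x hx
      obtain ⟨y, rfl⟩ := mem_powSubmodule.1 hx
      exact mem_powSubmodule.2 ⟨g • y, (smul_comm g _ y).symm⟩)
  one_smul x := by
    obtain ⟨x, rfl⟩ := proj_surjective k x
    exact congrArg (proj p k) (one_smul P x)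
  mul_smul g h x := by
    obtain ⟨x, rfl⟩ := proj_surjective k x
    exact congrArg (proj p k) (mul_smul g h x)
  smul_zero g := map_zero (Submodule.mapQ _ _ _ _)
  smul_add g := map_add (Submodule.mapQ _ _ _ _)

variable {p} in
@[simp] theorem smul_proj (k : ℕ) (g : P) (x : T) : g • proj p k x = proj p k (g • x) := rfl

variable {p} in
theorem smul_mul (r : ℕ) (g : P) (w : QuotPow p T 1) : g • mul p r w = mul p r (g • w) := by
  obtain ⟨x, rfl⟩ := proj_surjective 1 w
  rw [mul_proj, smul_proj, smul_proj, mul_proj, smul_comm]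

end quotPow

/-! ### Cochain sequences -/

/-- Let `D ⊆ X` be the set of degenerate tuples in `X = Gⁿ` (some entry is the identity), so that
normalized `n`-cochains are maps on `X` vanishing on `D`. `HasLevelLE p T r₀ D k α` says that
`α = (α_r)_{r ≥ r₀}`, `α_r ∈ Cⁿ(G, T / p^r N)` with `N = p T`, is a cochain sequence of level at
most `k`: it is given by `α_r = proj (ρ + p^(r-ω) σ)` with `ρ ∈ Cⁿ(G, T)`, `σ ∈ Cⁿ(G, p T)` and
`0 ≤ ω ≤ r₀` such that `ω ≤ k`. -/
def HasLevelLE (p : ℕ) [Fact p.Prime] (T : Type*) [AddCommGroup T] [Module ℤ_[p] T] (r₀ : ℕ)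
    {X : Type*} (D : Set X) (k : ℕ) (α : ∀ r : Set.Ici r₀, X → QuotPow p T ((r : ℕ) + 1)) :
    Prop :=
  ∃ ω : ℕ, ω ≤ r₀ ∧ ω ≤ k ∧ ∃ ρ σ : X → T,
    (∀ x ∈ D, ρ x = 0) ∧ (∀ x ∈ D, σ x = 0) ∧ (∀ x, σ x ∈ powSubmodule p T 1) ∧
    ∀ (r : Set.Ici r₀) (x : X),
      α r x = proj p ((r : ℕ) + 1) (ρ x + (p : ℤ_[p]) ^ ((r : ℕ) - ω) • σ x)

/-- The level condition for a sequence of 1-cochains. -/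
def HasLevelLE₁ (p : ℕ) [Fact p.Prime] (T : Type*) [AddCommGroup T] [Module ℤ_[p] T]
    {r₀ : ℕ} {G : Type*} [Group G] (k : ℕ)
    (f : ∀ r : Set.Ici r₀, G → QuotPow p T ((r : ℕ) + 1)) : Prop :=
  HasLevelLE p T r₀ {g : G | g = 1} k f

/-- The level condition for a sequence of 2-cocycles. -/
def HasLevelLE₂ (p : ℕ) [Fact p.Prime] (T : Type*) [AddCommGroup T] [Module ℤ_[p] T]
    {r₀ : ℕ} {P : Type*} [Group P] [DistribMulAction P T] [SMulCommClass P ℤ_[p] T] (k : ℕ)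
    (τ : ∀ r : Set.Ici r₀, Cocycle₂ P (QuotPow p T ((r : ℕ) + 1))) : Prop :=
  HasLevelLE p T r₀ {x : P × P | x.1 = 1 ∨ x.2 = 1} k (fun r x => (τ r).toFun x.1 x.2)

/-! ### The subgroups `E_r(U, f, W)` -/

section triples

variable {p : ℕ} [Fact p.Prime] {P : Type*} [Group P] {T : Type*} [AddCommGroup T]
  [Module ℤ_[p] T] [DistribMulAction P T] [SMulCommClass P ℤ_[p] T] {r₀ : ℕ}

/-- The set `ℰ` of triples `(U, f, W)`: `U ≤ P` is elementary abelian, `f` is a sequence of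
1-cochains on `U` of level at most `2m` with `Δ f = τ|_U`, and `W ≤ (T/pT)^U`. -/
@[ext]
structure Triple (m : ℕ) (τ : ∀ r : Set.Ici r₀, Cocycle₂ P (QuotPow p T ((r : ℕ) + 1))) where
  U : Subgroup P
  comm : ∀ x ∈ U, ∀ y ∈ U, x * y = y * x
  pow_eq_one : ∀ x ∈ U, x ^ p = 1
  f : ∀ r : Set.Ici r₀, U → QuotPow p T ((r : ℕ) + 1)
  level_le : HasLevelLE₁ p T (2 * m) f
  coboundary_eq : ∀ (r : Set.Ici r₀) (u v : U),
    (u : P) • f r v - f r (u * v) + f r u = (τ r).toFun u v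
  W : AddSubgroup (QuotPow p T 1)
  fixed : ∀ w ∈ W, ∀ u ∈ U, u • w = w

namespace Triple

variable {m : ℕ} {τ : ∀ r : Set.Ici r₀, Cocycle₂ P (QuotPow p T ((r : ℕ) + 1))}

theorem f_one (t : Triple m τ) (r : Set.Ici r₀) : t.f r 1 = 0 := by
  have h := t.coboundary_eq r 1 1
  simpa [(τ r).map_one_left] using h

/-- The homomorphism `j_r : W × U → G_{r+1}`, `(w, u) ↦ (p^r w - f_r(u), u)`. -/
def j (t : Triple m τ) (r : Set.Ici r₀) :
    Multiplicative t.W × t.U →* Extension (τ r) where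
  toFun x := ⟨mul p (r : ℕ) (x.1.toAdd : QuotPow p T 1) - t.f r x.2, x.2⟩
  map_one' := by
    ext
    · simp [t.f_one]
    · simp
  map_mul' x y := by
    ext
    · have h := t.coboundary_eq r x.2 y.2
      have h' := t.fixed _ y.1.toAdd.2 _ x.2.2
      simp only [Prod.fst_mul, Prod.snd_mul, Extension.mul_fst, ← h, toAdd_mul,
        AddSubgroup.coe_add, map_add, smul_sub, smul_mul, h']
      abel
    · simp

/-- The elementary abelian subgroup `E_r(U, f, W) = {(p^r w - f_r(u), u) | w ∈ W, u ∈ U}` of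
`G_{r+1}`. -/
def E (t : Triple m τ) (r : Set.Ici r₀) : QuillenCat p (Extension (τ r)) where
  carrier := (t.j r).range
  comm := by
    rintro _ ⟨⟨w, u⟩, rfl⟩ _ ⟨⟨w', u'⟩, rfl⟩
    rw [← map_mul, ← map_mul]
    congr 1
    ext
    · simp [add_comm]
    · exact t.comm _ u.2 _ u'.2
  pow_eq_one := by
    rintro _ ⟨⟨w, u⟩, rfl⟩
    rw [← map_pow]
    have h1 : w ^ p = 1 := by
      apply Multiplicative.toAdd.injective
      apply Subtype.ext
      obtain ⟨x, hx⟩ := proj_surjective (p := p) 1 (w.toAdd : QuotPow p T 1)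
      have h0 : proj p 1 (p • x) = (0 : QuotPow p T 1) := by
        refine (Submodule.Quotient.mk_eq_zero _).2 (mem_powSubmodule.2 ⟨x, ?_⟩)
        rw [pow_one, Nat.cast_smul_eq_nsmul]
      simpa [← hx] using h0
    have h2 : u ^ p = 1 := Subtype.ext (t.pow_eq_one _ u.2)
    rw [Prod.pow_mk, h1, h2]
    exact map_one _

/-- A subset `ℰ₀ ⊆ ℰ` such that for every conjugacy class of elementary abelian subgroups of
`G_{r₀+1}` there is exactly one triple in `ℰ₀` with `E_{r₀}(U, f, W)` in that class. -/
def IsTransversal (ℰ₀ : Set (Triple m τ)) : Prop :=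
  ∀ E : QuillenCat p (Extension (τ ⟨r₀, Set.self_mem_Ici⟩)),
    ∃! t : Triple m τ, t ∈ ℰ₀ ∧ E.AreConj (t.E ⟨r₀, Set.self_mem_Ici⟩)

/-- The objects `E_r(U, f, W)` of the Quillen category of `G_{r+1}`, for `(U, f, W) ∈ ℰ₀`. -/
def representatives (ℰ₀ : Set (Triple m τ)) (r : Set.Ici r₀) :
    ObjectProperty (QuillenCat p (Extension (τ r))) :=
  fun E => ∃ t ∈ ℰ₀, t.E r = E

end Triple

end triples

/-! ### Coclass families -/

/-- The `i`-th term `γ_i(G)` of the lower central series, where `γ_1(G) = G`. -/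
def gam (G : Type*) [Group G] (i : ℕ) : Subgroup G :=
  Subgroup.lowerCentralSeries (⊤ : Subgroup G) (i - 1)

instance (G : Type*) [Group G] (i : ℕ) : (gam G i).Normal := by
  unfold gam; infer_instance

/-- `Q` is a finite `p`-group of coclass `c`: it has nilpotency class `k` and order `p^(k+c)`. -/
def IsPGroupOfCoclass (p c : ℕ) (Q : Type*) [Group Q] : Prop :=
  ∃ k : ℕ, Nat.card Q = p ^ (k + c) ∧ gam Q (k + 1) = ⊥ ∧ ∀ i < k, gam Q (i + 1) ≠ ⊥

/-- `S` is an infinite pro-`p`-group of coclass `c`. (The first lower central quotient being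
finite, `S` is finitely generated, so the terms of the abstract lower central series are
closed.) -/
structure IsInfiniteProPOfCoclass (p c : ℕ) (S : Type*) [Group S] [TopologicalSpace S] :
    Prop where
  topologicalGroup : IsTopologicalGroup S
  compact : CompactSpace S
  totallyDisconnected : TotallyDisconnectedSpace S
  t2 : T2Space S
  index_eq : ∀ N : Subgroup S, N.Normal → IsOpen (N : Set S) → ∃ k : ℕ, N.index = p ^ k
  infinite : Infinite S
  coclass : ∃ i₀ : ℕ, ∀ i ≥ i₀, IsPGroupOfCoclass p c (S ⧸ gam S i)

/-- `(G_j)_j` is a coclass family of `p`-groups of coclass `c`. There are an infinite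
pro-`p`-group `S` of coclass `c` and `ℓ ≥ 1` such that `S_ℓ = S/γ_ℓ(S)` is a finite `p`-group of
coclass `c` and of order `p^m`, such that `S` is an extension of `S_ℓ` by a free `ℤ_p`-module `T`
of finite rank (so `T ≅ γ_ℓ(S)`) via a cocycle `ρ ∈ Z²(S_ℓ, T)`; and there are
`η ∈ Z³(S_ℓ, T)` and `σ ∈ C²(S_ℓ, T)` with `Δ σ = p^m η` such that, for all `j ≥ 3m + 1`, the
group `G_j` is the extension of `S_ℓ` by `T/p^j T` via the cocycle
`τ_j = proj_j (ρ + p^(j-m) σ)`. -/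
def IsCoclassFamily (p : ℕ) [Fact p.Prime] (c : ℕ) (G : ℕ → Type*) [∀ j, Group (G j)] : Prop :=
  ∃ (S : Type) (_ : Group S) (_ : TopologicalSpace S) (ℓ m : ℕ)
    (T : Type) (_ : AddCommGroup T) (_ : Module ℤ_[p] T)
    (_ : DistribMulAction (S ⧸ gam S ℓ) T) (_ : SMulCommClass (S ⧸ gam S ℓ) ℤ_[p] T)
    (ρ : Cocycle₂ (S ⧸ gam S ℓ) T) (e : S ≃* Extension ρ)
    (η : S ⧸ gam S ℓ → S ⧸ gam S ℓ → S ⧸ gam S ℓ → T) (σ : S ⧸ gam S ℓ → S ⧸ gam S ℓ → T),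
    IsInfiniteProPOfCoclass p c S ∧ 1 ≤ ℓ ∧
    IsPGroupOfCoclass p c (S ⧸ gam S ℓ) ∧ Nat.card (S ⧸ gam S ℓ) = p ^ m ∧
    Module.Free ℤ_[p] T ∧ Module.Finite ℤ_[p] T ∧
    (∀ s : S, (e s).snd = (s : S ⧸ gam S ℓ)) ∧
    -- `η` is a normalized 3-cocycle
    (∀ g h, η 1 g h = 0 ∧ η g 1 h = 0 ∧ η g h 1 = 0) ∧
    (∀ g h k l, g • η h k l - η (g * h) k l + η g (h * k) l - η g h (k * l) + η g h k = 0) ∧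
    -- `σ` is a normalized 2-cochain with `Δ σ = p^m η`
    (∀ g, σ 1 g = 0 ∧ σ g 1 = 0) ∧
    (∀ g h k, g • σ h k - σ (g * h) k + σ g (h * k) - σ g h = (p : ℤ_[p]) ^ m • η g h k) ∧
    ∀ j ≥ 3 * m + 1, ∃ τ : Cocycle₂ (S ⧸ gam S ℓ) (QuotPow p T j),
      (∀ g h, τ.toFun g h = proj p j (ρ.toFun g h + (p : ℤ_[p]) ^ (j - m) • σ g h)) ∧
      Nonempty (G j ≃* Extension τ)

end CochainSeq

end

noncomputable section

namespace CochainSeq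

/-! ### Torsion-freeness and separatedness -/

section module

variable {p : ℕ} [Fact p.Prime] {T : Type*} [AddCommGroup T] [Module ℤ_[p] T]

/-! An elementary abelian subgroup of `G_{r+1}` splits over its image `U` in `P`. The splitting is a
1-cochain `f_r` with `Δ f_r = τ_r` on `U`, and the kernel lies in the `p`-torsion of `T/p^(r+1)T`,
which is the image of `T/pT` under `mul`. So the subgroup is recorded by `U`, `f_r` and some `W`
fixed by `U`, and everything reduces to comparing equations over `T/p^(r+1)T` for different `r`.

Three facts make them comparable. The order of `P` is `p^m`, so averaging kills `H^1(U,T)` and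
`H^2(U,T)` after multiplication by `p^m` (`exists_pow_smul_eq_sub`,
`exists_pow_smul_eq_coboundary`). `T` is torsion-free, so powers of `p` cancel. `T` is `p`-adically
separated, so an identity valid for all `r` forces its `r`-independent part to hold in `T` itself.
The bound `r ≥ 3m` leaves room for the powers of `p` lost on the way.

With `H^2`, a splitting for one `r` extends to a whole cochain sequence
(`exists_level_le_of_splitting`), so triples reach every subgroup at every `r`
(`Triple.exists_E_eq`). With `H^1`, a homomorphism `W × U → W' × U'` induced by conjugation in one
`G_{r+1}` is induced by conjugation in all of them (`exists_transfer`, `Triple.IsMor.transfer`).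

Hence a single category of triples, independent of `r`, maps fully faithfully to each Quillen
category by `functorE`. Conjugacy of `E_r(t)` and `E_r(t')` then does not depend on `r`, so a
transversal at `r₀` is one at every `r`, and the skeletons are all isomorphic to the category of
triples. A coclass family is an instance of such a sequence with `ω = m`. -/

theorem proj_eq_zero_iff {k : ℕ} {x : T} : proj p k x = 0 ↔ ∃ y : T, (p : ℤ_[p]) ^ k • y = x :=
  (Submodule.Quotient.mk_eq_zero _).trans mem_powSubmodule

theorem pow_smul_cancel [Module.Free ℤ_[p] T] (k : ℕ) {x y : T}
    (h : (p : ℤ_[p]) ^ k • x = (p : ℤ_[p]) ^ k • y) : x = y :=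
  smul_right_injective T
    (pow_ne_zero k (Nat.cast_ne_zero.2 (Fact.out : p.Prime).ne_zero)) h

/-- Krull's intersection theorem over the local ring `ℤ_[p]`. It is what turns congruences modulo
all powers of `p` into identities in `T`. -/
theorem eq_zero_of_forall_exists_pow_smul [Module.Finite ℤ_[p] T] {x : T}
    (h : ∀ k : ℕ, ∃ y : T, (p : ℤ_[p]) ^ k • y = x) : x = 0 := by
  have hI : Ideal.span {(p : ℤ_[p])} ≠ ⊤ := by
    rw [← PadicInt.maximalIdeal_eq_span_p]
    exact (IsLocalRing.maximalIdeal.isMaximal _).ne_top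
  have := Ideal.iInf_pow_smul_eq_bot_of_isLocalRing (M := T) _ hI
  rw [← Submodule.mem_bot ℤ_[p], ← this, Submodule.mem_iInf]
  intro k
  obtain ⟨y, rfl⟩ := h k
  exact Submodule.smul_mem_smul (Ideal.pow_mem_pow (Ideal.mem_span_singleton_self _) k) trivial

theorem mul_injective [Module.Free ℤ_[p] T] (r : ℕ) :
    Function.Injective (mul p r : QuotPow p T 1 → QuotPow p T (r + 1)) := by
  refine (injective_iff_map_eq_zero (mul p r)).2 fun w hw => ?_
  obtain ⟨x, rfl⟩ := proj_surjective 1 w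
  obtain ⟨y, hy⟩ := proj_eq_zero_iff.1 ((mul_proj r x).symm.trans hw)
  refine proj_eq_zero_iff.2 ⟨y, pow_smul_cancel (p := p) r ?_⟩
  rw [← hy, smul_smul, ← pow_add]

theorem exists_mul_eq_of_nsmul_eq_zero [Module.Free ℤ_[p] T] {r : ℕ} {b : QuotPow p T (r + 1)}
    (hb : p • b = 0) : ∃ w, mul p r w = b := by
  obtain ⟨x, rfl⟩ := proj_surjective (r + 1) b
  rw [← map_nsmul, proj_eq_zero_iff] at hb
  obtain ⟨y, hy⟩ := hb
  refine ⟨proj p 1 y, ?_⟩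
  rw [mul_proj]
  congr 1
  refine pow_smul_cancel (p := p) 1 ?_
  rw [smul_smul, ← pow_add, add_comm, hy, pow_one, Nat.cast_smul_eq_nsmul]

/-- A cochain sequence of level at most `k ≤ r₀` can be written with the shift `ω = k`. -/
theorem HasLevelLE.exists_shift_eq {r₀ : ℕ} {X : Type*} {D : Set X} {k : ℕ}
    {α : ∀ r : Set.Ici r₀, X → QuotPow p T ((r : ℕ) + 1)} (h : HasLevelLE p T r₀ D k α)
    {l : ℕ} (hkl : k ≤ l) (hl : l ≤ r₀) :
    ∃ ρ σ : X → T, ∀ (r : Set.Ici r₀) (x : X),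
      α r x = proj p ((r : ℕ) + 1) (ρ x + (p : ℤ_[p]) ^ ((r : ℕ) - l) • σ x) := by
  obtain ⟨ω, -, hk, ρ, σ, -, -, -, hα⟩ := h
  -- The excess shift is absorbed into `σ`, which lets sequences of different levels be added.
  refine ⟨ρ, fun x => (p : ℤ_[p]) ^ (l - ω) • σ x, fun r x => ?_⟩
  have hr : r₀ ≤ r := r.2
  rw [hα, smul_smul, ← pow_add]
  congr 5
  omega

end module

/-! ### Cocycles of finite groups -/

section cocycle

variable {p : ℕ} [Fact p.Prime] {T : Type*} [AddCommGroup T] [Module ℤ_[p] T]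
  {P : Type*} [Group P] [DistribMulAction P T] [SMulCommClass P ℤ_[p] T]

omit [SMulCommClass P ℤ_[p] T] in
-- The order of `U` annihilates `H^1(U, T)`: sum the cocycle identity over the second argument. The
-- element `z` depends on `D` alone.
theorem exists_pow_smul_eq_sub {U : Type*} [Group U] {m : ℕ} [Finite U]
    (hU : Nat.card U ∣ p ^ m) (θ : U →* P) {D : U → T} (hD : ∀ u v, D (u * v) = D u + θ u • D v) :
    ∃ z : T, ∀ u, (p : ℤ_[p]) ^ m • D u = z - θ u • z := by
  have := Fintype.ofFinite U
  obtain ⟨n, hn⟩ := hU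
  refine ⟨n • ∑ v, D v, fun u => ?_⟩
  have h : ∑ v, D v = Nat.card U • D u + θ u • ∑ v, D v := by
    conv_lhs => rw [← Equiv.sum_comp (Equiv.mulLeft u) D]
    simp [hD, Finset.sum_add_distrib, Finset.smul_sum]
  rw [← Nat.cast_pow, Nat.cast_smul_eq_nsmul, hn, mul_comm, mul_smul, smul_comm (θ u), ← nsmul_sub,
    eq_sub_of_add_eq h.symm]

/-- The same averaging in degree 2. The explicit `μ u`, a multiple of the sum of `c u k` over `k`,
inherits normalization and values in `pT` from `c`; both are needed for `μ` to enter a cochain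
sequence. -/
theorem exists_pow_smul_eq_coboundary {U : Type*} [Group U] {m : ℕ} [Finite U]
    [DistribMulAction U T] (hU : Nat.card U ∣ p ^ m) {c : U → U → T}
    (h1 : ∀ u, c 1 u = 0) (hp : ∀ u v, c u v ∈ powSubmodule p T 1)
    (hc : ∀ u v w, u • c v w - c (u * v) w + c u (v * w) - c u v = 0) :
    ∃ μ : U → T, μ 1 = 0 ∧ (∀ u, μ u ∈ powSubmodule p T 1) ∧
      ∀ u v, (p : ℤ_[p]) ^ m • c u v = u • μ v - μ (u * v) + μ u := by
  have := Fintype.ofFinite U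
  obtain ⟨n, hn⟩ := hU
  refine ⟨fun u => n • ∑ k, c u k, by simp [h1],
    fun u => Submodule.smul_of_tower_mem _ _ (Submodule.sum_mem _ fun k _ => hp u k),
    fun u v => ?_⟩
  have h : Nat.card U • c u v = u • ∑ k, c v k - ∑ k, c (u * v) k + ∑ k, c u k := by
    rw [← Equiv.sum_comp (Equiv.mulLeft v) (c u), Finset.smul_sum, ← Finset.sum_sub_distrib,
      ← Finset.sum_add_distrib, Nat.card_eq_fintype_card, ← Finset.card_univ, ← Finset.sum_const]
    exact Finset.sum_congr rfl fun k _ => (sub_eq_zero.1 (hc u v k)).symm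
  rw [← Nat.cast_pow, Nat.cast_smul_eq_nsmul, hn, mul_comm, mul_smul, h, smul_comm u n, nsmul_add,
    nsmul_sub]

/-- The conjugation equation over `T / p^(r+1) T` can be transferred to `T / p^(s+1) T`. -/
theorem exists_transfer [Module.Free ℤ_[p] T] {U : Type*} [Group U] {m : ℕ} [Finite U]
    (hU : Nat.card U ∣ p ^ m) (θ : U →* P) {A B : U → T}
    (hA : ∀ u v, A (u * v) = A u + θ u • A v) {r s : ℕ} (hr : 3 * m ≤ r) (hs : 3 * m ≤ s) (x : T)
    (hx : ∀ u, ∃ ν : T, proj p (r + 1)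
      (A u + (p : ℤ_[p]) ^ (r - 2 * m) • B u + (θ u • x - x) + (p : ℤ_[p]) ^ r • ν) = 0) :
    ∃ x' : T, ∀ (u : U) (ν : T),
      proj p (r + 1)
        (A u + (p : ℤ_[p]) ^ (r - 2 * m) • B u + (θ u • x - x) + (p : ℤ_[p]) ^ r • ν) = 0 →
      proj p (s + 1)
        (A u + (p : ℤ_[p]) ^ (s - 2 * m) • B u + (θ u • x' - x') + (p : ℤ_[p]) ^ s • ν) = 0 := by
  obtain ⟨a, rfl⟩ := Nat.exists_eq_add_of_le hr
  obtain ⟨b, rfl⟩ := Nat.exists_eq_add_of_le hs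
  rw [show 3 * m + a - 2 * m = m + a by omega] at *
  rw [show 3 * m + b - 2 * m = m + b by omega] at *
  -- Solving for `A` shows that the cocycle `-A - (θ x - x)` is divisible by `p^(m+a)`, with an
  -- explicit quotient.
  have hD : ∀ u ν κ, (p : ℤ_[p]) ^ (3 * m + a + 1) • κ =
      A u + (p : ℤ_[p]) ^ (m + a) • B u + (θ u • x - x) + (p : ℤ_[p]) ^ (3 * m + a) • ν →
      (p : ℤ_[p]) ^ (m + a) •
        (B u + (p : ℤ_[p]) ^ (2 * m) • ν - (p : ℤ_[p]) ^ (2 * m + 1) • κ) =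
      -A u - (θ u • x - x) := by
    intro u ν κ h
    rw [smul_sub, smul_add, smul_smul, smul_smul, ← pow_add, ← pow_add,
      show m + a + 2 * m = 3 * m + a by ring, show m + a + (2 * m + 1) = 3 * m + a + 1 by ring, h]
    abel
  have hex : ∀ u, ∃ d : T, (p : ℤ_[p]) ^ (m + a) • d = -A u - (θ u • x - x) := fun u => by
    obtain ⟨ν, hν⟩ := hx u
    obtain ⟨κ, hκ⟩ := proj_eq_zero_iff.1 hν
    exact ⟨_, hD u ν κ hκ⟩
  choose D hDu using hex
  -- The quotient `D` is again a cocycle because `T` is torsion-free, so `p^m D` is a coboundary.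
  obtain ⟨z, hz⟩ := exists_pow_smul_eq_sub (p := p) hU θ (D := D) fun u v => by
    apply pow_smul_cancel (p := p) (m + a)
    rw [smul_add, ← smul_comm, hDu, hDu, hDu, hA, map_mul, mul_smul, smul_sub, smul_sub, smul_neg]
    abel
  -- Passing from `r` to `s` changes the equation by `(p^(m+b) - p^(m+a)) D`, which equals `(p^b -
  -- p^a)(z - θ z)`; this correction of `x` cancels it. The error term `κ` stays the same, and `z`
  -- does not depend on `ν`, so one `x'` serves all `ν`.
  refine ⟨x + (p : ℤ_[p]) ^ b • z - (p : ℤ_[p]) ^ a • z, fun u ν h => ?_⟩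
  obtain ⟨κ, hκ⟩ := proj_eq_zero_iff.1 h
  have h1 : D u = B u + (p : ℤ_[p]) ^ (2 * m) • ν - (p : ℤ_[p]) ^ (2 * m + 1) • κ :=
    pow_smul_cancel (p := p) (m + a) ((hDu u).trans (hD u ν κ hκ).symm)
  refine proj_eq_zero_iff.2 ⟨κ, ?_⟩
  have h2 : B u = D u - (p : ℤ_[p]) ^ (2 * m) • ν + (p : ℤ_[p]) ^ (2 * m + 1) • κ := by
    rw [h1]; abel
  have h3 : A u = -(θ u • x - x) - (p : ℤ_[p]) ^ (m + a) • D u := by rw [hDu]; abel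
  have h4 : θ u • z = z - (p : ℤ_[p]) ^ m • D u := by rw [hz]; abel
  simp only [smul_sub, smul_add, smul_comm (θ u) ((p : ℤ_[p]) ^ _), h4]
  rw [h2, h3]
  generalize θ u • x = y
  module

end cocycle

/-! ### Morphisms between the subgroups `E_r(U, f, W)` -/

namespace Triple

variable {p : ℕ} [Fact p.Prime] {P : Type*} [Group P] {T : Type*} [AddCommGroup T]
  [Module ℤ_[p] T] [DistribMulAction P T] [SMulCommClass P ℤ_[p] T] {r₀ : ℕ}
  {m : ℕ} {τ : ∀ r : Set.Ici r₀, Cocycle₂ P (QuotPow p T ((r : ℕ) + 1))}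

/-- The homomorphism `φ : W × U → W' × U'` is induced by conjugation by an element of
`G_{r+1}`. -/
def IsMor (t t' : Triple m τ) (r : Set.Ici r₀)
    (φ : Multiplicative t.W × t.U →* Multiplicative t'.W × t'.U) : Prop :=
  ∃ g : Extension (τ r), ∀ y, t'.j r (φ y) = g * t.j r y * g⁻¹

/-- The difference of the splittings of `τ_r` given by `f'_r` and by the `h`-conjugate of `f_r`. -/
def diff (t t' : Triple m τ) (h : P) (hU : ∀ u : t.U, h * u * h⁻¹ ∈ t'.U) (r : Set.Ici r₀)
    (u : t.U) : QuotPow p T ((r : ℕ) + 1) :=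
  -t'.f r ⟨h * u * h⁻¹, hU u⟩ + (τ r).toFun (h * u * h⁻¹) h + h • t.f r u - (τ r).toFun h u

/-- Both splittings lift the homomorphism `u ↦ h u h⁻¹` to `G_{r+1}`, and two lifts of one
homomorphism differ by a 1-cocycle. -/
theorem diff_mul (t t' : Triple m τ) (h : P) (hU : ∀ u : t.U, h * u * h⁻¹ ∈ t'.U)
    (r : Set.Ici r₀) (u v : t.U) :
    t.diff t' h hU r (u * v) = t.diff t' h hU r u + (h * u * h⁻¹) • t.diff t' h hU r v := by
  have e0 : (⟨h * (u * v : t.U) * h⁻¹, hU (u * v)⟩ : t'.U) =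
      ⟨h * u * h⁻¹, hU u⟩ * ⟨h * v * h⁻¹, hU v⟩ := by
    ext; simp [mul_assoc]
  have e1 : h * (u * v : t.U) * h⁻¹ = (h * u * h⁻¹) * (h * v * h⁻¹) := by simp [mul_assoc]
  have h1 := t'.coboundary_eq r ⟨h * u * h⁻¹, hU u⟩ ⟨h * v * h⁻¹, hU v⟩
  have h2 := congrArg (h • ·) (t.coboundary_eq r u v)
  have h3 := (τ r).coboundary_eq_zero (h * u * h⁻¹) (h * v * h⁻¹) h
  have h4 := (τ r).coboundary_eq_zero h u v
  have h5 := (τ r).coboundary_eq_zero (h * u * h⁻¹) h v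
  have h6 : (h * u * h⁻¹) * h = h * u := by group
  have h7 : (h * v * h⁻¹) * h = h * v := by group
  simp only [smul_add, smul_sub, smul_smul] at h2
  rw [diff, e0]
  simp only [diff, e1, smul_add, smul_sub, smul_neg, smul_smul, Subgroup.coe_mul] at *
  rw [h6] at h5 ⊢
  rw [h7] at h3
  linear_combination (norm := abel) h1 - h2 - h3 - h4 + h5

/-- The difference cocycles inherit the shape of a cochain sequence with shift `2m`. Their
`r`-independent part `A` is a cocycle over `T` itself, as `exists_transfer` requires. -/
theorem exists_diff_eq [Module.Finite ℤ_[p] T] (hr₀ : 2 * m ≤ r₀) (hτ : HasLevelLE₂ p T m τ)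
    (t t' : Triple m τ) (h : P) (hU : ∀ u : t.U, h * u * h⁻¹ ∈ t'.U) :
    ∃ A B : t.U → T, (∀ u v, A (u * v) = A u + (h * u * h⁻¹) • A v) ∧
      ∀ r u, t.diff t' h hU r u =
        proj p ((r : ℕ) + 1) (A u + (p : ℤ_[p]) ^ ((r : ℕ) - 2 * m) • B u) := by
  obtain ⟨ρ, σ, h0⟩ := HasLevelLE.exists_shift_eq hτ (l := 2 * m) (by omega) hr₀
  obtain ⟨ρ₁, σ₁, h1⟩ := HasLevelLE.exists_shift_eq t.level_le le_rfl hr₀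
  obtain ⟨ρ₂, σ₂, h2⟩ := HasLevelLE.exists_shift_eq t'.level_le le_rfl hr₀
  let A : t.U → T := fun u =>
    -ρ₂ ⟨h * u * h⁻¹, hU u⟩ + ρ (h * u * h⁻¹, h) + h • ρ₁ u - ρ (h, u)
  let B : t.U → T := fun u =>
    -σ₂ ⟨h * u * h⁻¹, hU u⟩ + σ (h * u * h⁻¹, h) + h • σ₁ u - σ (h, u)
  have hAB : ∀ r u, t.diff t' h hU r u =
      proj p ((r : ℕ) + 1) (A u + (p : ℤ_[p]) ^ ((r : ℕ) - 2 * m) • B u) := by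
    intro r u
    have e1 := h0 r (h * u * h⁻¹, h)
    have e2 := h0 r (h, u)
    dsimp only at e1 e2
    rw [diff, e1, e2, h1, h2, smul_proj, ← map_neg, ← map_add, ← map_add, ← map_sub]
    congr 1
    simp only [A, B, smul_add, smul_sub, smul_neg, smul_comm h ((p : ℤ_[p]) ^ _)]
    abel
  refine ⟨A, B, fun u v => sub_eq_zero.1 (eq_zero_of_forall_exists_pow_smul (p := p) fun k => ?_),
    hAB⟩
  -- At the index `r₀ + k` both the modulus and the `B`-term are divisible by `p^k`, hence so is the
  -- cocycle defect of `A`.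
  have e := t.diff_mul t' h hU ⟨r₀ + k, Nat.le_add_right _ _⟩ u v
  rw [hAB, hAB, hAB, smul_proj, ← map_add, ← sub_eq_zero, ← map_sub] at e
  obtain ⟨y, hy⟩ := proj_eq_zero_iff.1 e
  dsimp only at hy
  rw [show r₀ + k + 1 = k + (r₀ + 1) by ring, pow_add, mul_smul,
    show r₀ + k - 2 * m = k + (r₀ - 2 * m) by omega] at hy
  refine ⟨(p : ℤ_[p]) ^ (r₀ + 1) • y - ((p : ℤ_[p]) ^ (r₀ - 2 * m) • B (u * v) -
    (p : ℤ_[p]) ^ (r₀ - 2 * m) • B u -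
    (p : ℤ_[p]) ^ (r₀ - 2 * m) • (h * u * h⁻¹) • B v), ?_⟩
  rw [smul_sub, hy, smul_add (h * _ * _), smul_comm (h * _ * _)]
  generalize (h * u * h⁻¹) • A v = a
  generalize (h * u * h⁻¹) • B v = b
  clear_value A B
  module

theorem IsMor.transfer [Finite P] [Module.Free ℤ_[p] T] [Module.Finite ℤ_[p] T]
    (hP : Nat.card P = p ^ m) (hr₀ : 3 * m ≤ r₀) (hτ : HasLevelLE₂ p T m τ)
    {t t' : Triple m τ} {r : Set.Ici r₀}
    {φ : Multiplicative t.W × t.U →* Multiplicative t'.W × t'.U} (hφ : t.IsMor t' r φ)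
    (s : Set.Ici r₀) : t.IsMor t' s φ := by
  obtain ⟨⟨x, h⟩, hg⟩ := hφ
  obtain ⟨x, rfl⟩ := proj_surjective _ x
  -- Conjugation is written without inverses, which keeps the first components free of the inversion
  -- formula.
  simp only [eq_mul_inv_iff_mul_eq] at hg
  have hsnd : ∀ y, ((φ y).2 : P) = h * y.2 * h⁻¹ := fun y =>
    eq_mul_inv_iff_mul_eq.2 (congrArg Extension.snd (hg y))
  have hU : ∀ u : t.U, h * u * h⁻¹ ∈ t'.U := fun u => by
    rw [← hsnd (1, u)]; exact (φ (1, u)).2.2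
  have hsnd' : ∀ y, (φ y).2 = ⟨h * y.2 * h⁻¹, hU y.2⟩ := fun y => Subtype.ext (hsnd y)
  obtain ⟨A, B, hA, hAB⟩ := t.exists_diff_eq (by omega) hτ t' h hU
  -- the conjugation equation in the first components
  have key : ∀ (q : Set.Ici r₀) (z : T) (y) (ν : T),
      proj p 1 ν = (φ y).1.toAdd - h • (y.1.toAdd : QuotPow p T 1) →
      ((proj p ((q : ℕ) + 1) (A y.2 + (p : ℤ_[p]) ^ ((q : ℕ) - 2 * m) • B y.2 +
        ((h * y.2 * h⁻¹) • z - z) + (p : ℤ_[p]) ^ (q : ℕ) • ν) = 0) ↔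
      t'.j q (φ y) * ⟨proj p _ z, h⟩ = ⟨proj p _ z, h⟩ * t.j q y) := by
    intro q z y ν hν
    rw [map_add, map_add, ← hAB, ← mul_proj, hν, map_sub, map_sub, Extension.ext_iff]
    have : (t'.j q (φ y) * ⟨proj p _ z, h⟩ : Extension (τ q)).snd =
        (⟨proj p _ z, h⟩ * t.j q y : Extension (τ q)).snd := by
      simpa [j] using eq_mul_inv_iff_mul_eq.1 (hsnd y)
    rw [and_iff_left this, ← sub_eq_zero (b := Extension.fst _)]
    simp only [j, Extension.mul_fst, MonoidHom.coe_mk, OneHom.coe_mk, hsnd', diff, smul_proj,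
      smul_sub, smul_mul]
    refine Eq.congr_left ?_
    abel
  -- The part `h` of the conjugating element in `P` is kept; only its part in `T` changes.
  -- Solvability for each `u` is supplied by the elements `(1, u)`, and the effect of `φ` on `W` is
  -- carried by `ν`.
  obtain ⟨x', hx'⟩ := exists_transfer (p := p) (m := m) (r := r) (s := s) (P := P)
    (hP ▸ Subgroup.card_subgroup_dvd_card t.U)
    ((MulAut.conj h).toMonoidHom.comp t.U.subtype) (A := A) (B := B) hA
    (hr₀.trans r.2) (hr₀.trans s.2) x (fun u => by
      obtain ⟨ν, hν⟩ := proj_surjective (p := p) 1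
        ((φ (1, u)).1.toAdd - h • ((1 : Multiplicative t.W).toAdd : QuotPow p T 1) : QuotPow p T 1)
      exact ⟨ν, (key r x (1, u) ν hν).2 (hg _)⟩)
  refine ⟨⟨proj p _ x', h⟩, fun y => eq_mul_inv_iff_mul_eq.2 ?_⟩
  obtain ⟨ν, hν⟩ := proj_surjective (p := p) 1
    ((φ y).1.toAdd - h • (y.1.toAdd : QuotPow p T 1) : QuotPow p T 1)
  exact (key s x' y ν hν).1 (hx' y.2 ν ((key r x y ν hν).2 (hg y)))

end Triple

/-! ### Every elementary abelian subgroup is of the form `E_r(U, f, W)` -/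

theorem exists_section_of_zmodModule {p : ℕ} [Fact p.Prime] {A B : Type*} [AddCommGroup A]
    [AddCommGroup B] [Module (ZMod p) A] [Module (ZMod p) B] (f : A →+ B)
    (hf : Function.Surjective f) : ∃ s : B →+ A, ∀ b, f (s b) = b := by
  obtain ⟨s, hs⟩ := (AddMonoidHom.toZModLinearMap p f).exists_rightInverse_of_surjective
    (LinearMap.range_eq_top.2 hf)
  exact ⟨s.toAddMonoidHom, fun b => LinearMap.congr_fun hs b⟩

theorem exists_section_of_elementary_comm {p : ℕ} [Fact p.Prime] {A B : Type*} [AddCommGroup A]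
    [AddCommGroup B] (hA : ∀ x : A, p • x = 0) (f : A →+ B) (hf : Function.Surjective f) :
    ∃ s : B →+ A, ∀ b, f (s b) = b := by
  have hB : ∀ x : B, p • x = 0 := fun x => by
    obtain ⟨y, rfl⟩ := hf x
    rw [← map_nsmul, hA, map_zero]
  let _ : Module (ZMod p) A := AddCommGroup.zmodModule hA
  let _ : Module (ZMod p) B := AddCommGroup.zmodModule hB
  exact exists_section_of_zmodModule (p := p) f hf

/-- Elementary abelian groups are vector spaces over `ZMod p`, so surjections between them split. -/
theorem exists_section_of_elementary {p : ℕ} [Fact p.Prime] {A B : Type*} [Group A] [Group B]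
    (hA : ∀ x y : A, x * y = y * x) (hAp : ∀ x : A, x ^ p = 1) (f : A →* B)
    (hf : Function.Surjective f) : ∃ s : B →* A, ∀ b, f (s b) = b := by
  let : CommGroup A := { ‹Group A› with mul_comm := hA }
  let : CommGroup B := { ‹Group B› with
    mul_comm := fun x y => by
      obtain ⟨x, rfl⟩ := hf x
      obtain ⟨y, rfl⟩ := hf y
      rw [← map_mul, hA, map_mul] }
  obtain ⟨s, hs⟩ := exists_section_of_elementary_comm (p := p) (A := Additive A) (B := Additive B)
    hAp (MonoidHom.toAdditive f) hf
  exact ⟨MonoidHom.toAdditive.symm s, hs⟩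

section surjectivity

variable {p : ℕ} [Fact p.Prime] {P : Type*} [Group P] {T : Type*} [AddCommGroup T]
  [Module ℤ_[p] T] [DistribMulAction P T] [SMulCommClass P ℤ_[p] T] {r₀ : ℕ}
  {m : ℕ} {τ : ∀ r : Set.Ici r₀, Cocycle₂ P (QuotPow p T ((r : ℕ) + 1))}

/-- A splitting of `τ_r` on `U` for a single `r` extends to a cochain sequence of splittings. -/
theorem exists_level_le_of_splitting [Finite P] [Module.Free ℤ_[p] T] [Module.Finite ℤ_[p] T]
    (hP : Nat.card P = p ^ m) (hr₀ : 3 * m ≤ r₀) (hτ : HasLevelLE₂ p T m τ) (U : Subgroup P)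
    (r : Set.Ici r₀) (f : U → QuotPow p T ((r : ℕ) + 1))
    (hf : ∀ u v : U, (u : P) • f v - f (u * v) + f u = (τ r).toFun u v) :
    ∃ F : ∀ s : Set.Ici r₀, U → QuotPow p T ((s : ℕ) + 1), F r = f ∧ HasLevelLE₁ p T (2 * m) F ∧
      ∀ (s : Set.Ici r₀) (u v : U),
        (u : P) • F s v - F s (u * v) + F s u = (τ s).toFun u v := by
  obtain ⟨ω, -, hω, ρ, σ, hρ, hσ, hσp, h0⟩ := hτ
  have hτ : ∀ (s : Set.Ici r₀) (u v : P), (τ s).toFun u v =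
      proj p ((s : ℕ) + 1) (ρ (u, v) + (p : ℤ_[p]) ^ ((s : ℕ) - ω) • σ (u, v)) :=
    fun s u v => h0 s (u, v)
  have hcomm : ∀ (k : ℕ) (u : U) (x : T), (p : ℤ_[p]) ^ k • u • x = u • (p : ℤ_[p]) ^ k • x :=
    fun k u x => (smul_comm (u : P) _ x).symm
  have hf1 : f 1 = 0 := by simpa [(τ r).map_one_left] using hf 1 1
  have hr : r₀ ≤ (r : ℕ) := r.2
  -- Possible since `m + ω ≤ 2m ≤ r`; the sequence built below has shift `m + ω`.
  obtain ⟨a, ha⟩ : ∃ a, (r : ℕ) = m + ω + a := Nat.exists_eq_add_of_le (by omega)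
  -- a normalized lift of `f`
  obtain ⟨g, hg1, hg⟩ : ∃ g : U → T, g 1 = 0 ∧ ∀ u, proj p ((r : ℕ) + 1) (g u) = f u := by
    choose g hg using fun u => proj_surjective (p := p) ((r : ℕ) + 1) (f u)
    classical
    refine ⟨Function.update g 1 0, by simp, fun u => ?_⟩
    by_cases hu : u = 1
    · subst hu; simp [hf1]
    · rw [Function.update_of_ne hu, hg]
  have hκ : ∀ u v : U, ∃ κ : T, (p : ℤ_[p]) ^ ((r : ℕ) + 1) • κ =
      u • g v - g (u * v) + g u - (ρ (u, v) + (p : ℤ_[p]) ^ ((r : ℕ) - ω) • σ (u, v)) := by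
    intro u v
    rw [← proj_eq_zero_iff, map_sub, ← hτ r u v, ← hf u v, ← hg, ← hg, ← hg, map_add, map_sub]
    exact sub_self _
  choose κ hκ using hκ
  -- the 2-cocycle `c = σ + p ^ (ω + 1) κ`
  let c : U → U → T := fun u v => σ (u, v) + (p : ℤ_[p]) ^ (ω + 1) • κ u v
  have hc : ∀ u v : U, (p : ℤ_[p]) ^ (m + a) • c u v =
      u • g v - g (u * v) + g u - ρ (u, v) := by
    intro u v
    have h := hκ u v
    rw [ha, show m + ω + a - ω = m + a by omega] at h
    simp only [c, smul_add, smul_smul, ← pow_add]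
    rw [show m + a + (ω + 1) = m + ω + a + 1 by ring, h]
    abel
  -- The term with `σ` tends to zero as the index grows, so `ρ` is a cocycle over `T`. Then `p^(m+a)
  -- c = Δ g - ρ` is one, and so is `c` after cancelling.
  have hρc : ∀ u v w : P,
      u • ρ (v, w) - ρ (u * v, w) + ρ (u, v * w) - ρ (u, v) = 0 := by
    intro u v w
    refine eq_zero_of_forall_exists_pow_smul (p := p) fun k => ?_
    have h := (τ ⟨r₀ + k, Nat.le_add_right _ _⟩).coboundary_eq_zero u v w
    have h' := hτ ⟨r₀ + k, Nat.le_add_right _ _⟩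
    rw [h' v w, h' (u * v) w, h' u (v * w), h' u v, smul_proj, ← map_sub, ← map_add,
      ← map_sub] at h
    obtain ⟨y, hy⟩ := proj_eq_zero_iff.1 h
    dsimp only at hy
    rw [show r₀ + k + 1 = k + (r₀ + 1) by ring, pow_add, mul_smul,
      show r₀ + k - ω = k + (r₀ - ω) by omega, smul_add, smul_comm u] at hy
    refine ⟨(p : ℤ_[p]) ^ (r₀ + 1) • y - (p : ℤ_[p]) ^ (r₀ - ω) • (u • σ (v, w) -
      σ (u * v, w) + σ (u, v * w) - σ (u, v)), ?_⟩
    rw [smul_sub, hy]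
    generalize u • ρ (v, w) = x
    generalize u • σ (v, w) = y
    module
  obtain ⟨μ, hμ1, hμp, hμ⟩ := exists_pow_smul_eq_coboundary (p := p) (m := m) (c := c)
    (hP ▸ Subgroup.card_subgroup_dvd_card U)
    (fun u => pow_smul_cancel (p := p) (m + a) (by
      rw [hc, hρ (((1 : U) : P), (u : P)) (Or.inl rfl), hg1, one_smul, one_mul, smul_zero]
      abel))
    (fun u v => Submodule.add_mem _ (hσp _) (mem_powSubmodule.2
      ⟨(p : ℤ_[p]) ^ ω • κ u v, by rw [smul_smul, ← pow_add, add_comm]⟩))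
    (fun u v w => pow_smul_cancel (p := p) (m + a) (by
      have h := hρc u v w
      have h1 : ((u * v : U) : P) = u * v := rfl
      have h2 : ((v * w : U) : P) = v * w := rfl
      rw [smul_sub, smul_add, smul_sub, hcomm, hc, hc, hc, hc, smul_zero, ← neg_eq_zero,
        ← h, h1, h2, mul_assoc u v w]
      simp only [smul_add, smul_sub, mul_smul, Subgroup.smul_def]
      abel))
  -- Since `Δ μ = p^m c`, the coboundary before projection is `ρ + p^(s-ω) c`, which is `ρ + p^(s-ω)
  -- σ` up to `p^(s+1) κ`. At `s = r` the two terms in `μ` cancel and `f` is recovered.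
  refine ⟨fun s u => proj p ((s : ℕ) + 1)
    (g u - (p : ℤ_[p]) ^ a • μ u + (p : ℤ_[p]) ^ ((s : ℕ) - (m + ω)) • μ u), ?_,
    ⟨m + ω, by omega, by omega, fun u => g u - (p : ℤ_[p]) ^ a • μ u, μ, ?_, ?_, hμp,
      fun _ _ => rfl⟩, fun s u v => ?_⟩
  · funext u
    change proj p _ (g u - _ + _) = f u
    rw [← hg, show (r : ℕ) - (m + ω) = a by omega, sub_add_cancel]
  · rintro u rfl
    simp [hg1, hμ1]
  · rintro u rfl
    exact hμ1
  · have hs : r₀ ≤ (s : ℕ) := s.2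
    obtain ⟨b, hb⟩ : ∃ b, (s : ℕ) = m + ω + b := Nat.exists_eq_add_of_le (by omega)
    beta_reduce
    rw [hτ s u v, smul_proj, ← map_sub, ← map_add, ← sub_eq_zero, ← map_sub]
    refine proj_eq_zero_iff.2 ⟨κ u v, ?_⟩
    rw [hb, Nat.add_sub_cancel_left, show m + ω + b - ω = m + b by omega]
    have h1 := hc u v
    have h2 := hμ u v
    simp only [Subgroup.smul_def] at h1 h2
    have h3 : ρ (↑u, ↑v) = (u : P) • g v - g (u * v) + g u - (p : ℤ_[p]) ^ (m + a) • c u v := by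
      rw [h1]; abel
    have h4 : (u : P) • μ v = (p : ℤ_[p]) ^ m • c u v + μ (u * v) - μ u := by
      rw [h2]; abel
    simp only [smul_add, smul_sub, smul_comm (u : P) ((p : ℤ_[p]) ^ _), h4]
    rw [h3]
    generalize (u : P) • g v = x
    simp only [c]
    module

theorem Extension.pow_mk_one {M : Type*} [AddCommGroup M] [DistribMulAction P M]
    {τ : Cocycle₂ P M} (b : M) (n : ℕ) : (⟨b, 1⟩ : Extension τ) ^ n = ⟨n • b, 1⟩ := by
  induction n with
  | zero => rw [pow_zero, zero_smul]; rfl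
  | succ n ih => rw [pow_succ, ih]; ext <;> simp [succ_nsmul, τ.map_one_left]

/-- A section of the projection of `E` onto its image `U` in `P` provides `f_r`, and the kernel of
that projection provides `W`. -/
theorem Triple.exists_E_eq [Finite P] [Module.Free ℤ_[p] T] [Module.Finite ℤ_[p] T]
    (hP : Nat.card P = p ^ m) (hr₀ : 3 * m ≤ r₀) (hτ : HasLevelLE₂ p T m τ) (r : Set.Ici r₀)
    (E : QuillenCat p (Extension (τ r))) : ∃ t : Triple m τ, t.E r = E := by
  let π : Extension (τ r) →* P := ⟨⟨Extension.snd, rfl⟩, fun _ _ => rfl⟩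
  obtain ⟨s, hs⟩ := exists_section_of_elementary (p := p)
    (fun x y : E.carrier => Subtype.ext (E.comm x x.2 y y.2))
    (fun x : E.carrier => Subtype.ext (E.pow_eq_one x x.2))
    (π.subgroupMap E.carrier) (π.subgroupMap_surjective E.carrier)
  have hs' : ∀ u, (s u : Extension (τ r)).snd = u := fun u => congrArg Subtype.val (hs u)
  obtain ⟨F, hFr, hF, hFτ⟩ := exists_level_le_of_splitting hP hr₀ hτ (E.carrier.map π) r
    (fun u => -(s u : Extension (τ r)).fst) (fun u v => by
      have h := congrArg (fun x : E.carrier => (x : Extension (τ r)).fst) (map_mul s u v)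
      simp only [Subgroup.coe_mul, Extension.mul_fst, hs'] at h
      rw [h, smul_neg]
      abel)
  let t : Triple m τ :=
    { U := E.carrier.map π
      comm := by
        rintro _ ⟨x, hx, rfl⟩ _ ⟨y, hy, rfl⟩
        rw [← map_mul, ← map_mul, E.comm x hx y hy]
      pow_eq_one := by
        rintro _ ⟨x, hx, rfl⟩
        rw [← map_pow, E.pow_eq_one x hx, map_one]
      f := F
      level_le := hF
      coboundary_eq := hFτ
      W :=
        { carrier := {w | (⟨mul p r w, 1⟩ : Extension (τ r)) ∈ E.carrier}
          zero_mem' := by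
            rw [Set.mem_ofPred_eq, map_zero]
            exact E.carrier.one_mem
          add_mem' := fun {v w} hv hw => by
            rw [Set.mem_ofPred_eq, show (⟨mul p r (v + w), 1⟩ : Extension (τ r)) =
              ⟨mul p r v, 1⟩ * ⟨mul p r w, 1⟩ from
                Extension.ext (by simp [(τ r).map_one_left]) (by simp)]
            exact E.carrier.mul_mem hv hw
          neg_mem' := fun {w} hw => by
            rw [Set.mem_ofPred_eq, show (⟨mul p r (-w), 1⟩ : Extension (τ r)) =
              ⟨mul p r w, 1⟩⁻¹ from Extension.ext (by simp [(τ r).map_one_right]) (by simp)]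
            exact E.carrier.inv_mem hw }
      fixed := by
        rintro w hw _ ⟨x, hx, rfl⟩
        -- Commutativity of `E` says that `U` acts trivially on the kernel; injectivity of `mul`
        -- moves this to `W`.
        have h := congrArg Extension.fst (E.comm x hx _ hw)
        simp only [Extension.mul_fst, (τ r).map_one_left, (τ r).map_one_right, one_smul, add_zero,
          add_comm (mul p r w), smul_mul, add_right_inj] at h
        exact mul_injective _ h }
  have htf : ∀ u, t.f r u = -(s u : Extension (τ r)).fst := congrFun hFr
  have hj : ∀ y, t.j r y = (⟨mul p r (y.1.toAdd : QuotPow p T 1), 1⟩ : Extension (τ r)) *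
      (s y.2 : Extension (τ r)) := by
    intro y
    ext
    · simp [Triple.j, htf, (τ r).map_one_left]
    · simp [Triple.j, hs']
  refine ⟨t, QuillenCat.ext (le_antisymm ?_ fun x hx => ?_)⟩
  · rintro _ ⟨y, rfl⟩
    rw [hj]
    exact E.carrier.mul_mem y.1.toAdd.2 (s y.2).2
  · let u : t.U := ⟨π x, x, hx, rfl⟩
    have hb : x * (s u : Extension (τ r))⁻¹ ∈ E.carrier :=
      E.carrier.mul_mem hx (E.carrier.inv_mem (s u).2)
    have hb1 : (x * (s u : Extension (τ r))⁻¹).snd = 1 := by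
      rw [Extension.mul_snd, Extension.inv_snd, hs']
      exact mul_inv_cancel _
    have hb2 : x * (s u : Extension (τ r))⁻¹ = ⟨(x * (s u : Extension (τ r))⁻¹).fst, 1⟩ :=
      Extension.ext rfl hb1
    have hbp := E.pow_eq_one _ hb
    rw [hb2, Extension.pow_mk_one] at hbp
    -- Kernel elements have exponent `p`, hence come from `T/pT`.
    obtain ⟨w, hw⟩ := exists_mul_eq_of_nsmul_eq_zero (congrArg Extension.fst hbp)
    rw [← hw] at hb2
    refine ⟨(Multiplicative.ofAdd ⟨w, show _ ∈ E.carrier from hb2 ▸ hb⟩, u), ?_⟩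
    rw [hj]
    exact (congrArg (· * (s u : Extension (τ r))) hb2.symm).trans (inv_mul_cancel_right _ _)

end surjectivity

universe u v w

/-- A fully faithful functor that is bijective on objects is an isomorphism of categories. -/
theorem nonempty_catIso_of_fullyFaithful_of_bijective {C D : Type u} [Category.{v} C]
    [Category.{v} D] (F : C ⥤ D) [F.Full] [F.Faithful] (hF : Function.Bijective F.obj) :
    Nonempty (Cat.of C ≅ Cat.of D) := by
  obtain ⟨g, hgF, hFg⟩ := Function.bijective_iff_has_inverse.1 hF
  let G : D ⥤ C :=
    { obj := g
      map := fun {X Y} f => F.preimage (eqToHom (hFg X) ≫ f ≫ eqToHom (hFg Y).symm)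
      map_id := fun X => F.map_injective (by simp)
      map_comp := fun f g => F.map_injective (by simp) }
  refine ⟨⟨F.toCatHom, G.toCatHom, congrArg Functor.toCatHom (?_ : F ⋙ G = 𝟭 C),
    congrArg Functor.toCatHom (?_ : G ⋙ F = 𝟭 D)⟩⟩
  · refine CategoryTheory.Functor.ext hgF fun X Y f => F.map_injective ?_
    simp [G, eqToHom_map]
  · refine CategoryTheory.Functor.ext hFg fun X Y f => ?_
    simp [G]

/-! ### Invariance of the Quillen category under isomorphisms -/

namespace QuillenCat

variable {p : ℕ} {G H : Type*} [Group G] [Group H]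

@[simp] theorem comp_toHom_apply {E E' E'' : QuillenCat p G} (φ : E ⟶ E') (ψ : E' ⟶ E'')
    (x : E.carrier) : Hom.toHom (φ ≫ ψ) x = Hom.toHom ψ (Hom.toHom φ x) := rfl

@[simp] theorem id_toHom_apply (E : QuillenCat p G) (x : E.carrier) : Hom.toHom (𝟙 E) x = x := rfl

/-- The image of an elementary abelian subgroup under an isomorphism. -/
def map (e : G ≃* H) (E : QuillenCat p G) : QuillenCat p H where
  carrier := E.carrier.map e.toMonoidHom
  comm := by
    rintro _ ⟨x, hx, rfl⟩ _ ⟨y, hy, rfl⟩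
    rw [← map_mul, E.comm x hx y hy, map_mul]
  pow_eq_one := by
    rintro _ ⟨x, hx, rfl⟩
    rw [← map_pow, E.pow_eq_one x hx, map_one]

/-- An elementary abelian subgroup is isomorphic to its image under an isomorphism. -/
def mapEquiv (e : G ≃* H) (E : QuillenCat p G) : E.carrier ≃* (map e E).carrier :=
  e.subgroupMap E.carrier

theorem coe_mapEquiv (e : G ≃* H) (E : QuillenCat p G) (x : E.carrier) :
    (mapEquiv e E x : H) = e x := rfl

/-- The functor induced by an isomorphism of groups. -/
def mapFunctor (p : ℕ) (e : G ≃* H) : QuillenCat p G ⥤ QuillenCat p H where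
  obj := map e
  map {E E'} φ :=
    { toHom := ((mapEquiv e E').toMonoidHom.comp φ.toHom).comp (mapEquiv e E).symm.toMonoidHom
      exists_conj := by
        obtain ⟨g, hg⟩ := φ.exists_conj
        refine ⟨e g, fun x => ?_⟩
        obtain ⟨x, rfl⟩ := (mapEquiv e E).surjective x
        simp [coe_mapEquiv, hg] }
  map_id E := Hom.ext (MonoidHom.ext fun x => (mapEquiv e E).apply_symm_apply x)
  map_comp {E E' E''} φ ψ := Hom.ext (MonoidHom.ext fun x =>
    congrArg (fun y => mapEquiv e E'' (ψ.toHom y)) ((mapEquiv e E').symm_apply_apply _).symm)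

theorem mapFunctor_map_toHom_apply (e : G ≃* H) {E E' : QuillenCat p G} (φ : E ⟶ E')
    (x : E.carrier) : Hom.toHom ((mapFunctor p e).map φ) (mapEquiv e E x) =
      mapEquiv e E' (Hom.toHom φ x) :=
  congrArg (fun y => mapEquiv e E' (Hom.toHom φ y)) ((mapEquiv e E).symm_apply_apply x)

instance (e : G ≃* H) : (mapFunctor p e).Faithful where
  map_injective {E E'} φ ψ h := by
    refine Hom.ext (MonoidHom.ext fun x => (mapEquiv e E').injective ?_)
    rw [← mapFunctor_map_toHom_apply, h, mapFunctor_map_toHom_apply]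

instance (e : G ≃* H) : (mapFunctor p e).Full where
  map_surjective {E E'} ψ := by
    refine ⟨⟨((mapEquiv e E').symm.toMonoidHom.comp (Hom.toHom ψ)).comp
      (mapEquiv e E).toMonoidHom, ?_⟩, ?_⟩
    · obtain ⟨g, hg⟩ := Hom.exists_conj ψ
      refine ⟨e.symm g, fun x => e.injective ?_⟩
      have h1 := hg (mapEquiv e E x)
      have h2 := congrArg Subtype.val ((mapEquiv e E').apply_symm_apply
        (Hom.toHom ψ (mapEquiv e E x)))
      simp only [map_mul, map_inv, MulEquiv.apply_symm_apply]
      exact h2.trans h1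
    · refine Hom.ext (MonoidHom.ext fun x => ?_)
      obtain ⟨x, rfl⟩ := (mapEquiv e E).surjective x
      exact (mapFunctor_map_toHom_apply e _ x).trans ((mapEquiv e E').apply_symm_apply _)

instance (e : G ≃* H) : (mapFunctor p e).EssSurj where
  mem_essImage E := by
    refine ⟨map e.symm E, ⟨eqToIso (QuillenCat.ext ?_)⟩⟩
    change (E.carrier.map e.symm.toMonoidHom).map e.toMonoidHom = E.carrier
    rw [Subgroup.map_map]
    convert Subgroup.map_id E.carrier
    ext x
    simp

/-- Isomorphic groups have equivalent Quillen categories. -/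
def equivalenceOfMulEquiv (p : ℕ) (e : G ≃* H) : QuillenCat p G ≌ QuillenCat p H :=
  haveI : (mapFunctor p e).IsEquivalence := {}
  (mapFunctor p e).asEquivalence

theorem AreConj.symm {E E' : QuillenCat p G} (h : E.AreConj E') : E'.AreConj E := by
  obtain ⟨g, hg⟩ := h
  refine ⟨g⁻¹, ?_⟩
  rw [hg, Subgroup.map_map]
  convert (Subgroup.map_id E.carrier).symm
  ext x
  simp [mul_assoc]

theorem AreConj.trans {E E' E'' : QuillenCat p G} (h : E.AreConj E') (h' : E'.AreConj E'') :
    E.AreConj E'' := by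
  obtain ⟨g, hg⟩ := h
  obtain ⟨g', hg'⟩ := h'
  refine ⟨g' * g, ?_⟩
  rw [hg', hg, Subgroup.map_map]
  congr 1
  ext x
  simp [mul_assoc]

theorem areConj_refl (E : QuillenCat p G) : E.AreConj E :=
  ⟨1, by
    convert (Subgroup.map_id E.carrier).symm
    ext x
    simp⟩

theorem AreConj.isIsomorphic {E E' : QuillenCat p G} (h : E.AreConj E') : IsIsomorphic E E' := by
  obtain ⟨g, hg⟩ := h
  obtain ⟨c, hc, hp⟩ := E'
  -- Making `E'` literally the image lets `subgroupMap` have the right codomain without transport.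
  obtain rfl : c = _ := hg
  let e := (MulAut.conj g).subgroupMap E.carrier
  refine ⟨⟨⟨e.toMonoidHom, g, fun x => rfl⟩, ⟨e.symm.toMonoidHom, g⁻¹, fun x => ?_⟩, ?_, ?_⟩⟩
  · obtain ⟨x, rfl⟩ := e.surjective x
    have h : (e x : G) = g * x * g⁻¹ := rfl
    have h' : e.symm.toMonoidHom (e x) = x := e.symm_apply_apply x
    refine (congrArg Subtype.val h').trans ?_
    change (x : G) = g⁻¹ * (g * x * g⁻¹) * g⁻¹⁻¹
    group
  · exact Hom.ext (MonoidHom.ext fun x => e.symm_apply_apply x)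
  · exact Hom.ext (MonoidHom.ext fun x => e.apply_symm_apply x)

/-- A morphism only conjugates `E` into `E'`; the inverse gives surjectivity. -/
theorem areConj_of_iso {E E' : QuillenCat p G} (e : E ≅ E') : E.AreConj E' := by
  obtain ⟨g, hg⟩ := Hom.exists_conj e.hom
  refine ⟨g, le_antisymm (fun y hy => ?_) ?_⟩
  · have h : Hom.toHom e.hom (Hom.toHom e.inv ⟨y, hy⟩) = ⟨y, hy⟩ := by
      rw [← comp_toHom_apply, e.inv_hom_id, id_toHom_apply]
    refine ⟨Hom.toHom e.inv ⟨y, hy⟩, (Hom.toHom e.inv ⟨y, hy⟩).2, ?_⟩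
    exact (hg _).symm.trans (congrArg Subtype.val h)
  · rintro _ ⟨x, hx, rfl⟩
    have h := (Hom.toHom e.hom ⟨x, hx⟩).2
    rwa [hg] at h

end QuillenCat

/-! ### The category of triples -/

namespace Triple

variable {p : ℕ} [Fact p.Prime] {P : Type u} [Group P] {T : Type w} [AddCommGroup T]
  [Module ℤ_[p] T] [DistribMulAction P T] [SMulCommClass P ℤ_[p] T] {r₀ : ℕ}
  {m : ℕ} {τ : ∀ r : Set.Ici r₀, Cocycle₂ P (QuotPow p T ((r : ℕ) + 1))}

theorem j_injective [Module.Free ℤ_[p] T] (t : Triple m τ) (r : Set.Ici r₀) :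
    Function.Injective (t.j r) := by
  refine (injective_iff_map_eq_one _).2 fun x hx => ?_
  have h2 : x.2 = 1 := Subtype.ext (congrArg Extension.snd hx)
  have h1 : mul p (r : ℕ) (x.1.toAdd : QuotPow p T 1) - t.f r x.2 = 0 := congrArg Extension.fst hx
  rw [h2, t.f_one, sub_zero, ← map_zero (mul p (r : ℕ))] at h1
  exact Prod.ext (Multiplicative.toAdd.injective (Subtype.ext (mul_injective _ h1))) h2

/-- The isomorphism `W × U ≃ E_r(U, f, W)`. -/
def equivE [Module.Free ℤ_[p] T] (t : Triple m τ) (r : Set.Ici r₀) :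
    Multiplicative t.W × t.U ≃* (t.E r).carrier :=
  MonoidHom.ofInjective (t.j_injective r)

theorem coe_equivE [Module.Free ℤ_[p] T] (t : Triple m τ) (r : Set.Ici r₀)
    (y : Multiplicative t.W × t.U) : (t.equivE r y : Extension (τ r)) = t.j r y := rfl

/-- The category with objects a set of triples, and with morphisms the homomorphisms
`W × U → W' × U'` that are induced by conjugation in all `G_{r+1}`. -/
structure Cat (ℰ₀ : Set (Triple m τ)) where
  triple : Triple m τ
  mem : triple ∈ ℰ₀

/-- Morphisms of the category of triples. -/
@[ext]
structure Cat.Hom {ℰ₀ : Set (Triple m τ)} (t t' : Cat ℰ₀) where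
  toHom : Multiplicative t.triple.W × t.triple.U →* Multiplicative t'.triple.W × t'.triple.U
  isMor : ∀ r, t.triple.IsMor t'.triple r toHom

instance (ℰ₀ : Set (Triple m τ)) : Category (Cat ℰ₀) where
  Hom := Cat.Hom
  id t := ⟨MonoidHom.id _, fun r => ⟨1, by simp⟩⟩
  comp φ ψ := ⟨ψ.toHom.comp φ.toHom, fun r => by
    obtain ⟨g, hg⟩ := φ.isMor r
    obtain ⟨h, hh⟩ := ψ.isMor r
    exact ⟨h * g, fun x => by simp [hg, hh, mul_assoc]⟩⟩

/-- The functor `(U, f, W) ↦ E_r(U, f, W)`. -/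
def functorE [Module.Free ℤ_[p] T] (ℰ₀ : Set (Triple m τ)) (r : Set.Ici r₀) :
    Cat ℰ₀ ⥤ (representatives ℰ₀ r).FullSubcategory where
  obj t := ⟨t.triple.E r, t.triple, t.mem, rfl⟩
  map {t t'} φ := ObjectProperty.homMk
    ⟨((t'.triple.equivE r).toMonoidHom.comp φ.toHom).comp (t.triple.equivE r).symm.toMonoidHom, by
      obtain ⟨g, hg⟩ := φ.isMor r
      refine ⟨g, fun x => ?_⟩
      obtain ⟨x, rfl⟩ := (t.triple.equivE r).surjective x
      simp [coe_equivE, hg]⟩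
  map_id t := by
    refine ObjectProperty.hom_ext _ (QuillenCat.Hom.ext (MonoidHom.ext fun x => ?_))
    exact (t.triple.equivE r).apply_symm_apply x
  map_comp {t t' t''} φ ψ := by
    refine ObjectProperty.hom_ext _ (QuillenCat.Hom.ext (MonoidHom.ext fun x => ?_))
    exact congrArg (fun y => t''.triple.equivE r (ψ.toHom y))
      ((t'.triple.equivE r).symm_apply_apply _).symm

theorem functorE_map_toHom_apply [Module.Free ℤ_[p] T] {ℰ₀ : Set (Triple m τ)} (r : Set.Ici r₀)
    {t t' : Cat ℰ₀} (φ : t ⟶ t') (x : Multiplicative t.triple.W × t.triple.U) :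
    QuillenCat.Hom.toHom ((functorE ℰ₀ r).map φ).hom (t.triple.equivE r x) =
      t'.triple.equivE r (Cat.Hom.toHom φ x) :=
  congrArg (fun y => t'.triple.equivE r (Cat.Hom.toHom φ y))
    ((t.triple.equivE r).symm_apply_apply x)

instance [Module.Free ℤ_[p] T] (ℰ₀ : Set (Triple m τ)) (r : Set.Ici r₀) :
    (functorE ℰ₀ r).Faithful where
  map_injective {t t'} φ ψ h := by
    refine Cat.Hom.ext (MonoidHom.ext fun x => (t'.triple.equivE r).injective ?_)
    rw [← functorE_map_toHom_apply, h, functorE_map_toHom_apply]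

variable [Module.Free ℤ_[p] T] [Module.Finite ℤ_[p] T]

/-- Every morphism between the subgroups `E_r` comes from a homomorphism `W × U → W' × U'` that is
induced by conjugation in all `G_{s+1}`. -/
theorem exists_isMor [Finite P] (hP : Nat.card P = p ^ m) (hr₀ : 3 * m ≤ r₀)
    (hτ : HasLevelLE₂ p T m τ) {t t' : Triple m τ} {r : Set.Ici r₀} (ψ : t.E r ⟶ t'.E r) :
    ∃ φ : Multiplicative t.W × t.U →* Multiplicative t'.W × t'.U, (∀ s, t.IsMor t' s φ) ∧
      ∀ x, t'.equivE r (φ x) = QuillenCat.Hom.toHom ψ (t.equivE r x) := by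
  refine ⟨((t'.equivE r).symm.toMonoidHom.comp (QuillenCat.Hom.toHom ψ)).comp
    (t.equivE r).toMonoidHom, IsMor.transfer hP hr₀ hτ (r := r) ?_,
    fun x => (t'.equivE r).apply_symm_apply _⟩
  obtain ⟨g, hg⟩ := QuillenCat.Hom.exists_conj ψ
  refine ⟨g, fun x => ?_⟩
  rw [← coe_equivE, ← coe_equivE, ← hg]
  exact congrArg Subtype.val ((t'.equivE r).apply_symm_apply _)

theorem full_functorE [Finite P] (hP : Nat.card P = p ^ m) (hr₀ : 3 * m ≤ r₀)
    (hτ : HasLevelLE₂ p T m τ) (ℰ₀ : Set (Triple m τ)) (r : Set.Ici r₀) :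
    (functorE ℰ₀ r).Full where
  map_surjective {t t'} ψ := by
    obtain ⟨φ, hφ, h⟩ := exists_isMor hP hr₀ hτ (t := t.triple) (t' := t'.triple) ψ.hom
    refine ⟨⟨φ, hφ⟩, ObjectProperty.hom_ext _ (QuillenCat.Hom.ext (MonoidHom.ext fun x => ?_))⟩
    obtain ⟨x, rfl⟩ := (t.triple.equivE r).surjective x
    rw [functorE_map_toHom_apply]
    exact h x

/-! ### Conjugacy across levels, transversals and skeletons. -/

theorem areConj_transfer [Finite P] (hP : Nat.card P = p ^ m) (hr₀ : 3 * m ≤ r₀)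
    (hτ : HasLevelLE₂ p T m τ) {t t' : Triple m τ} {r : Set.Ici r₀}
    (h : (t.E r).AreConj (t'.E r)) (s : Set.Ici r₀) : (t.E s).AreConj (t'.E s) := by
  -- On the category of all triples the isomorphism at level `r` lifts along a fully faithful
  -- functor and is then mapped to level `s`.
  have := full_functorE hP hr₀ hτ Set.univ r
  let X : Cat (Set.univ : Set (Triple m τ)) := ⟨t, trivial⟩
  let Y : Cat (Set.univ : Set (Triple m τ)) := ⟨t', trivial⟩
  obtain ⟨e⟩ := h.isIsomorphic
  let e' : (functorE Set.univ r).obj X ≅ (functorE Set.univ r).obj Y :=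
    ObjectProperty.isoMk _ e
  exact QuillenCat.areConj_of_iso ((representatives Set.univ s).ι.mapIso
    ((functorE Set.univ s).mapIso ((functorE Set.univ r).preimageIso e')))

theorem exists_isTransversal [Finite P] (hP : Nat.card P = p ^ m) (hr₀ : 3 * m ≤ r₀)
    (hτ : HasLevelLE₂ p T m τ) : ∃ ℰ₀ : Set (Triple m τ), IsTransversal ℰ₀ := by
  let S : Setoid (QuillenCat p (Extension (τ ⟨r₀, Set.self_mem_Ici⟩))) :=
    ⟨QuillenCat.AreConj, QuillenCat.areConj_refl, QuillenCat.AreConj.symm,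
      QuillenCat.AreConj.trans⟩
  choose c hc using fun E => exists_E_eq hP hr₀ hτ ⟨r₀, Set.self_mem_Ici⟩ E
  -- Triples are chosen per conjugacy class, not per subgroup, so that each class receives only one.
  refine ⟨Set.range fun q : Quotient S => c q.out, fun E => ⟨c (Quotient.mk S E).out,
    ⟨⟨_, rfl⟩, ?_⟩, ?_⟩⟩
  · rw [hc]
    exact QuillenCat.AreConj.symm (Quotient.exact (Quotient.out_eq (Quotient.mk S E)))
  · rintro _ ⟨⟨q, rfl⟩, h⟩
    rw [hc] at h
    have : Quotient.mk S E = q := (Quotient.sound h).trans (Quotient.out_eq q)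
    rw [this]

theorem IsTransversal.eq_of_areConj {ℰ₀ : Set (Triple m τ)} (h : IsTransversal ℰ₀) [Finite P]
    (hP : Nat.card P = p ^ m) (hr₀ : 3 * m ≤ r₀) (hτ : HasLevelLE₂ p T m τ) {t t' : Triple m τ}
    (ht : t ∈ ℰ₀) (ht' : t' ∈ ℰ₀) {r : Set.Ici r₀} (hc : (t.E r).AreConj (t'.E r)) : t = t' :=
  (h (t.E _)).unique ⟨ht, QuillenCat.areConj_refl _⟩ ⟨ht', areConj_transfer hP hr₀ hτ hc _⟩

theorem IsTransversal.isSkeletonOf {ℰ₀ : Set (Triple m τ)} (h : IsTransversal ℰ₀) [Finite P]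
    (hP : Nat.card P = p ^ m) (hr₀ : 3 * m ≤ r₀) (hτ : HasLevelLE₂ p T m τ) (r : Set.Ici r₀) :
    IsSkeletonOf (QuillenCat p (Extension (τ r))) (representatives ℰ₀ r).FullSubcategory
      (representatives ℰ₀ r).ι where
  skel := by
    rintro ⟨_, t, ht, rfl⟩ ⟨_, t', ht', rfl⟩ ⟨e⟩
    obtain rfl := h.eq_of_areConj hP hr₀ hτ ht ht'
      (QuillenCat.areConj_of_iso ((representatives ℰ₀ r).ι.mapIso e))
    rfl
  eqv :=
    { essSurj := ⟨fun E => by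
        obtain ⟨t, rfl⟩ := exists_E_eq hP hr₀ hτ r E
        -- The subgroup at level `r` is compared with the transversal at level `r₀` through its
        -- triple `t`, and the conjugacy is carried back.
        obtain ⟨t', ⟨ht', hc⟩, -⟩ := h (t.E _)
        obtain ⟨e⟩ := (areConj_transfer hP hr₀ hτ hc r).isIsomorphic
        exact ⟨⟨t'.E r, t', ht', rfl⟩, ⟨e.symm⟩⟩⟩ }

theorem IsTransversal.nonempty_iso {ℰ₀ : Set (Triple m τ)} (h : IsTransversal ℰ₀) [Finite P]
    (hP : Nat.card P = p ^ m) (hr₀ : 3 * m ≤ r₀) (hτ : HasLevelLE₂ p T m τ) (r r' : Set.Ici r₀) :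
    Nonempty (CategoryTheory.Cat.of (representatives ℰ₀ r).FullSubcategory ≅
      CategoryTheory.Cat.of (representatives ℰ₀ r').FullSubcategory) := by
  have key : ∀ s : Set.Ici r₀, Nonempty (CategoryTheory.Cat.of (Cat ℰ₀) ≅
      CategoryTheory.Cat.of (representatives ℰ₀ s).FullSubcategory) := fun s => by
    have := full_functorE hP hr₀ hτ ℰ₀ s
    refine nonempty_catIso_of_fullyFaithful_of_bijective (functorE ℰ₀ s) ⟨?_, ?_⟩
    -- Transversality turns equality of the two subgroups into equality of the triples.
    · rintro ⟨t, ht⟩ ⟨t', ht'⟩ e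
      have e' : t.E s = t'.E s := congrArg ObjectProperty.FullSubcategory.obj e
      obtain rfl := h.eq_of_areConj hP hr₀ hτ ht ht' (r := s)
        (e' ▸ QuillenCat.areConj_refl (t.E s) : (t.E s).AreConj (t'.E s))
      rfl
    · rintro ⟨_, t, ht, rfl⟩
      exact ⟨⟨t, ht⟩, rfl⟩
  obtain ⟨e⟩ := key r
  obtain ⟨e'⟩ := key r'
  exact ⟨e.symm ≪≫ e'⟩

end Triple

/-- The Quillen categories of the groups `G_{r+1}` are all equivalent. -/
theorem nonempty_quillenCat_equivalence {p : ℕ} [Fact p.Prime] {P : Type*} [Group P] {T : Type*}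
    [AddCommGroup T] [Module ℤ_[p] T] [DistribMulAction P T] [SMulCommClass P ℤ_[p] T] {r₀ m : ℕ}
    {τ : ∀ r : Set.Ici r₀, Cocycle₂ P (QuotPow p T ((r : ℕ) + 1))} [Module.Free ℤ_[p] T]
    [Module.Finite ℤ_[p] T] [Finite P] (hP : Nat.card P = p ^ m) (hr₀ : 3 * m ≤ r₀)
    (hτ : HasLevelLE₂ p T m τ) (r r' : Set.Ici r₀) :
    Nonempty (QuillenCat p (Extension (τ r)) ≌ QuillenCat p (Extension (τ r'))) := by
  obtain ⟨ℰ₀, h⟩ := Triple.exists_isTransversal hP hr₀ hτ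
  have := (h.isSkeletonOf hP hr₀ hτ r).eqv
  have := (h.isSkeletonOf hP hr₀ hτ r').eqv
  obtain ⟨e⟩ := h.nonempty_iso hP hr₀ hτ r r'
  exact ⟨((Triple.representatives ℰ₀ r).ι.asEquivalence.symm.trans (Cat.equivOfIso e)).trans
    (Triple.representatives ℰ₀ r').ι.asEquivalence⟩

/-- Almost all groups of a coclass family have equivalent Quillen categories. -/
theorem IsCoclassFamily.nonempty_quillenCat_equivalence {p : ℕ} [Fact p.Prime] {c : ℕ}
    {G : ℕ → Type*} [∀ j, Group (G j)] (h : IsCoclassFamily p c G) :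
    ∃ j₀ : ℕ, ∀ j ≥ j₀, ∀ j' ≥ j₀, Nonempty (QuillenCat p (G j) ≌ QuillenCat p (G j')) := by
  obtain ⟨S, _, _, ℓ, m, T, _, _, _, _, ρ, -, η, σ, -, -, -, hm, _, _, -, -, -, hσ, -, hG⟩ := h
  have hG' : ∀ r : Set.Ici (3 * m), _ := fun r => hG ((r : ℕ) + 1) (Nat.succ_le_succ r.2)
  choose τ hτ e using hG'
  have : Finite (S ⧸ gam S ℓ) :=
    Nat.finite_of_card_ne_zero (hm ▸ pow_ne_zero m (Fact.out : p.Prime).ne_zero)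
  have hlevel : HasLevelLE₂ p T m τ := by
    -- With `j = r + 1`, the term `p^(j-m) σ` is `p^(r-m) (p σ)`: the index shift supplies the
    -- values in `pT`.
    refine ⟨m, by omega, le_rfl, fun x => ρ.toFun x.1 x.2, fun x => (p : ℤ_[p]) • σ x.1 x.2,
      ?_, ?_, fun x => mem_powSubmodule.2 ⟨_, by rw [pow_one]⟩, fun r x => ?_⟩
    · rintro ⟨x, y⟩ (rfl | rfl)
      exacts [ρ.map_one_left _, ρ.map_one_right _]
    · rintro ⟨x, y⟩ (rfl | rfl)
      · simp [(hσ y).1]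
      · simp [(hσ x).2]
    · have hr : 3 * m ≤ (r : ℕ) := r.2
      dsimp only
      rw [hτ, smul_smul, ← pow_succ, show (r : ℕ) + 1 - m = (r : ℕ) - m + 1 by omega]
  refine ⟨3 * m + 1, fun j hj j' hj' => ?_⟩
  obtain ⟨r, rfl⟩ : ∃ r, j = r + 1 := ⟨j - 1, by omega⟩
  obtain ⟨r', rfl⟩ : ∃ r', j' = r' + 1 := ⟨j' - 1, by omega⟩
  obtain ⟨e₁⟩ := e ⟨r, Nat.le_of_succ_le_succ hj⟩
  obtain ⟨e₂⟩ := e ⟨r', Nat.le_of_succ_le_succ hj'⟩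
  obtain ⟨f⟩ := CochainSeq.nonempty_quillenCat_equivalence hm le_rfl hlevel
    ⟨r, Nat.le_of_succ_le_succ hj⟩ ⟨r', Nat.le_of_succ_le_succ hj'⟩
  exact ⟨((QuillenCat.equivalenceOfMulEquiv p e₁).trans f).trans
    (QuillenCat.equivalenceOfMulEquiv p e₂).symm⟩

end CochainSeq

end

theorem mainTheorem2 (p : ℕ) [Fact p.Prime] :
    (∀ {P : Type*} [Group P] {T : Type*} [AddCommGroup T] [Module ℤ_[p] T]
      [Module.Free ℤ_[p] T] [Module.Finite ℤ_[p] T]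
      [DistribMulAction P T] [SMulCommClass P ℤ_[p] T]
      (m r₀ : ℕ), Nat.card P = p ^ m → 1 ≤ m → 3 * m ≤ r₀ →
      ∀ (τ : ∀ r : Set.Ici r₀, CochainSeq.Cocycle₂ P (CochainSeq.QuotPow p T ((r : ℕ) + 1))),
      CochainSeq.HasLevelLE₂ p T m τ →
      (∃ ℰ₀ : Set (CochainSeq.Triple m τ), CochainSeq.Triple.IsTransversal ℰ₀) ∧
      (∀ ℰ₀ : Set (CochainSeq.Triple m τ), CochainSeq.Triple.IsTransversal ℰ₀ →
        (∀ r : Set.Ici r₀,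
          IsSkeletonOf (CochainSeq.QuillenCat p (CochainSeq.Extension (τ r)))
            (CochainSeq.Triple.representatives ℰ₀ r).FullSubcategory
            (CochainSeq.Triple.representatives ℰ₀ r).ι) ∧
        (∀ r r' : Set.Ici r₀,
          Nonempty (Cat.of (CochainSeq.Triple.representatives ℰ₀ r).FullSubcategory ≅
            Cat.of (CochainSeq.Triple.representatives ℰ₀ r').FullSubcategory))) ∧
      (∀ r r' : Set.Ici r₀,
        Nonempty (CochainSeq.QuillenCat p (CochainSeq.Extension (τ r)) ≌
          CochainSeq.QuillenCat p (CochainSeq.Extension (τ r'))))) ∧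
    (∀ (c : ℕ) (G : ℕ → Type*) [∀ j, Group (G j)], CochainSeq.IsCoclassFamily p c G →
      ∃ j₀ : ℕ, ∀ j ≥ j₀, ∀ j' ≥ j₀,
        Nonempty (CochainSeq.QuillenCat p (G j) ≌ CochainSeq.QuillenCat p (G j'))) := by
  refine ⟨?_, fun c G _ h => h.nonempty_quillenCat_equivalence⟩
  intro P _ T _ _ _ _ _ _ m r₀ hP _ hr₀ τ hτ
  have : Finite P :=
    Nat.finite_of_card_ne_zero (hP ▸ pow_ne_zero m (Fact.out : p.Prime).ne_zero)
  exact ⟨CochainSeq.Triple.exists_isTransversal hP hr₀ hτ,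
    fun ℰ₀ h => ⟨h.isSkeletonOf hP hr₀ hτ, h.nonempty_iso hP hr₀ hτ⟩,
    CochainSeq.nonempty_quillenCat_equivalence hP hr₀ hτ⟩
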